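/- Let $L/K$ be a nontrivial separable field extension (not necessarily algebraic; separable means that $F\otimes_K L$ is reduced for every field extension $F/K$) such that $K$ is algebraically closed in $L$. Let $n\ge m\ge 0$, let $A=K[x_1,\dots,x_m]$, let $J$ be an ideal of $A$ such that $A/J$ has finite length as an $A$-module, and let $B=L[x_1,\dots,x_n]$, viewed as an $A$-algebra via $K\subseteq L$ and $x_i\mapsto x_i$. Set $R=A/J$ and $S=B/JB$. For $f\in S$ let $c(f)$ denote the Ohm–Rush content of $f$ over $R$, that is, the intersection of all ideals $I$ of $R$ such that $f\in IS$. Call $f\in S$ Gaussian over $R$ if $c(fg)=c(f)c(g)$ for all $g\in S$. Call an ideal $I$ of $R$ locally principal if $IR_{\mathfrak p}$ is a principal ideal of $R_{\mathfrak p}$ for every maximal ideal $\mathfrak p$ of $R$. Then the following are equivalent: (a) for every $f\in S$ that is Gaussian over $R$, the ideal $c(f)$ is locally principal; (b) $R$ is Gorenstein, i.e. $R$ is Noetherian and for every maximal ideal $\mathfrak p$ of $R$ the local ring $R_{\mathfrak p}$ has finite injective dimension as a module over itself. -/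

import Mathlib

open scoped TensorProduct

universe u v

/-- The Ohm-Rush content of an element `f` of an `R`-module `M`: the intersection of all ideals
`I` of `R` with `f ∈ I M`. -/
def ohmRushContent (R : Type u) {M : Type v} [CommRing R] [AddCommGroup M] [Module R M]
    (f : M) : Ideal R :=
  sInf {I : Ideal R | f ∈ I • (⊤ : Submodule R M)}

/-- An element `f` of an `R`-algebra `S` is Gaussian over `R` if `c(f g) = c(f) c(g)` for
all `g` in `S`, where `c` is the Ohm-Rush content. -/
def IsGaussianElement (R : Type u) {S : Type v} [CommRing R] [CommRing S] [Algebra R S]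
    (f : S) : Prop :=
  ∀ g : S, ohmRushContent R (f * g) = ohmRushContent R f * ohmRushContent R g

/-- An ideal is locally principal if its extension to the localization at each maximal ideal
is principal. -/
def IsLocallyPrincipalIdeal {R : Type u} [CommRing R] (I : Ideal R) : Prop :=
  ∀ (p : Ideal R) [p.IsMaximal],
    (I.map (algebraMap R (Localization.AtPrime p))).IsPrincipal

/-- A ring is Gorenstein if it is Noetherian and its localization at each maximal ideal has finite
injective dimension as a module over itself. -/
def IsGorensteinRing (R : Type u) [CommRing R] : Prop :=
  IsNoetherianRing R ∧ ∀ (p : Ideal R) [p.IsMaximal], ∃ d : ℕ,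
    CategoryTheory.HasInjectiveDimensionLE
      (ModuleCat.of (Localization.AtPrime p) (Localization.AtPrime p)) d

/-- Separability of a field extension `L / K` that need not be algebraic: `F ⊗ L` is reduced for
every field extension `F` of `K`. (The algebraic closure of `K` is among the fields `F` tested.) -/
def IsSeparableFieldExtension (K : Type u) (L : Type v) [Field K] [Field L] [Algebra K L] : Prop :=
  ∀ (F : Type u) [Field F] [Algebra K F], IsReduced (F ⊗[K] L)

/-- The ring homomorphism `K[x_1, ..., x_m] → L[x_1, ..., x_n]`, for `m ≤ n`, that extends `K → L`
and sends `x_i` to `x_i`. -/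
noncomputable def polyExtHom (K : Type u) (L : Type v) [Field K] [Field L] [Algebra K L]
    {m n : ℕ} (h : m ≤ n) : MvPolynomial (Fin m) K →+* MvPolynomial (Fin n) L :=
  (MvPolynomial.rename (R := L) (Fin.castLE h)).toRingHom.comp
    (MvPolynomial.map (algebraMap K L))

/-- The induced ring homomorphism `A / J → B / J B`, where `A = K[x_1, ..., x_m]` and
`B = L[x_1, ..., x_n]`. -/
noncomputable def polyExtQuotHom (K : Type u) (L : Type v) [Field K] [Field L] [Algebra K L]
    {m n : ℕ} (h : m ≤ n) (J : Ideal (MvPolynomial (Fin m) K)) :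
    MvPolynomial (Fin m) K ⧸ J →+* MvPolynomial (Fin n) L ⧸ J.map (polyExtHom K L h) :=
  Ideal.quotientMap (J.map (polyExtHom K L h)) (polyExtHom K L h) Ideal.le_comap_map

/-! Finite length makes `R` a finite `K`-algebra, and `S` is free over `R` on the image of a
`K`-basis of `T = L[x_{m+1}, …, x_n]`. Contents can therefore be read off coordinates. For such `R`,
Gorenstein means that every `p`-socle is zero or simple: finite injective dimension over an Artinian
local ring forces self-injectivity, and simple socles produce a functional `φ : R → K` with
nondegenerate pairing `φ(xy)`.

Local principality implies simple socles. Choose `t` in `L` outside `K`, hence transcendental over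
`K`. For `a`, `b` in the `p`-socle, `f = a + bt` has content `(a, b)`. It is Gaussian: if `g ∈ pS`,
both sides vanish; otherwise some 2×2 minor of the coordinates of `g` and `tg` is nonzero modulo
`p`, and Cramer's rule recovers `a` and `b` from the coordinates of `fg`
(`mem_of_add_mul_mul_mem_map`). Principality of `(a, b)` at `p` then makes the socle simple.

Simple socles imply local principality by a dimension count. Let `f` be Gaussian with content `I`.
If `fg = 0`, the coordinates of `g` lie in `ann I`; comparing ranks over `T` gives `dim p ≤ dim pI +
dim ann I` (`IsGaussianElement.finrank_le`). The pairing gives `dim I + dim ann I ≤ dim R`. Hence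
`dim I/pI ≤ dim R/p`, so `I/pI` is generated by one element, and Nakayama finishes. -/

/-! ### Socles, Frobenius functionals and self-injectivity -/

section Socle

/-- At each maximal ideal `p`, any two elements killed by `p`, the first of them nonzero, are such
that the first generates the second: the `p`-socle is zero or simple. -/
def HasSimpleSocles (R : Type*) [CommRing R] : Prop :=
  ∀ (p : Ideal R), p.IsMaximal → ∀ a b : R, (∀ x ∈ p, x * a = 0) → (∀ x ∈ p, x * b = 0) →
    a ≠ 0 → b ∈ Ideal.span {a}

/-- An element killed by `p` is a vector over the field `R/p`, on which `s` acts invertibly. -/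
theorem mem_ideal_of_mul_mem_of_notMem {R : Type*} [CommRing R] {p : Ideal R} (hp : p.IsMaximal)
    {I : Ideal R} {s x : R} (hs : s ∉ p) (hx : ∀ y ∈ p, y * x = 0) (h : s * x ∈ I) : x ∈ I := by
  obtain ⟨y, i, hi, hyi⟩ := hp.exists_inv hs
  have : x = y * (s * x) := by
    linear_combination (-x) * hyi + hx i hi
  rw [this]
  exact I.mul_mem_left _ h

theorem mem_span_singleton_of_localization {R : Type*} [CommRing R] {p : Ideal R}
    [hp : p.IsMaximal] {a b : R} (ha : ∀ x ∈ p, x * a = 0) (hb : ∀ x ∈ p, x * b = 0)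
    (h : algebraMap R (Localization.AtPrime p) b ∈
      Ideal.span {algebraMap R (Localization.AtPrime p) a}) : b ∈ Ideal.span {a} := by
  obtain ⟨z, hz⟩ := Ideal.mem_span_singleton'.1 h
  obtain ⟨⟨r, s⟩, hrs⟩ := IsLocalization.surj p.primeCompl z
  have h1 : algebraMap R (Localization.AtPrime p) (s * b) =
      algebraMap R (Localization.AtPrime p) (r * a) := by
    rw [map_mul, map_mul, ← hz, ← hrs]
    ring
  obtain ⟨c, hc⟩ := (IsLocalization.eq_iff_exists p.primeCompl _).1 h1
  have h2 : (s : R) * b - r * a = 0 := by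
    have := mem_ideal_of_mul_mem_of_notMem hp (I := ⊥) (s := c) (x := (s : R) * b - r * a) c.2
      (fun y hy ↦ by linear_combination (s : R) * hb y hy - r * ha y hy)
      (by rw [Ideal.mem_bot]; linear_combination hc)
    simpa using this
  refine mem_ideal_of_mul_mem_of_notMem hp s.2 hb ?_
  rw [sub_eq_zero.1 h2]
  exact Ideal.mul_mem_left _ _ (Ideal.mem_span_singleton_self a)

/-- Both `1 ↦ a` and `1 ↦ b` define maps `R/p → R`, the first injective. Extending the second along
the first gives an endomorphism of `R`, that is, a multiplication carrying `a` to `b`. -/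
theorem hasSimpleSocles_of_injective {R : Type*} [CommRing R] (hR : Module.Injective R R) :
    HasSimpleSocles R := by
  intro p hp a b ha hb hne
  let f : R ⧸ p →ₗ[R] R := p.liftQ (LinearMap.toSpanSingleton R R a) (fun x hx ↦ by
    simpa using ha x hx)
  let g : R ⧸ p →ₗ[R] R := p.liftQ (LinearMap.toSpanSingleton R R b) (fun x hx ↦ by
    simpa using hb x hx)
  have hf : Function.Injective f := by
    rw [← LinearMap.ker_eq_bot]
    refine Submodule.ker_liftQ_eq_bot' _ _ ?_
    refine hp.eq_of_le ?_ (fun x hx ↦ by simpa using ha x hx)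
    rw [Ideal.ne_top_iff_one]
    simpa using hne
  obtain ⟨h, hh⟩ := hR.out f hf g
  have h1 := hh (Submodule.Quotient.mk 1)
  have h2 : f (Submodule.Quotient.mk 1) = a := one_smul R a
  have h3 : g (Submodule.Quotient.mk 1) = b := one_smul R b
  rw [h2, h3] at h1
  rw [← h1, Ideal.mem_span_singleton']
  refine ⟨h 1, ?_⟩
  have := h.map_smul a 1
  simp only [smul_eq_mul, mul_one] at this
  rw [this, mul_comm]

theorem exists_isMaximal_mul_annihilated {R : Type*} [CommRing R] [IsArtinianRing R] {x : R}
    (hx : x ≠ 0) : ∃ p : Ideal R, p.IsMaximal ∧ ∃ r : R, r * x ≠ 0 ∧ ∀ y ∈ p, y * (r * x) = 0 := by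
  have : Nontrivial (Ideal.span {x} : Ideal R) := by
    rw [Submodule.nontrivial_iff_ne_bot, Ne, Ideal.span_singleton_eq_bot]
    exact hx
  obtain ⟨p, hp⟩ := associatedPrimes.nonempty R (Ideal.span {x} : Ideal R)
  obtain ⟨hpp, ⟨z, hz⟩, hzp⟩ := (isAssociatedPrime_iff.1 hp)
  obtain ⟨r, rfl⟩ := Ideal.mem_span_singleton'.1 hz
  have hpm : p.IsMaximal := IsArtinianRing.isMaximal_of_isPrime p
  have key : ∀ y, y ∈ p ↔ y * (r * x) = 0 := by
    intro y
    rw [hzp, Submodule.mem_colon_singleton, Submodule.mem_bot, ← Subtype.coe_inj]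
    simp
  refine ⟨p, hpm, r, fun h0 ↦ hpp.ne_top ?_, fun y hy ↦ (key y).1 hy⟩
  rw [Ideal.eq_top_iff_one, key, h0, mul_zero]

/-- A finite algebra over a field with simple socles is a Frobenius algebra. -/
theorem HasSimpleSocles.exists_nondegenerate_functional {K R : Type*} [Field K] [CommRing R]
    [Algebra K R] [Module.Finite K R] (hR : HasSimpleSocles R) :
    ∃ φ : R →ₗ[K] K, ∀ x, (∀ y, φ (y * x) = 0) → x = 0 := by
  have : IsArtinianRing R := IsArtinianRing.of_finite K R
  -- The index set consists of the maximal ideals with nonzero socle; `a` picks one socle element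
  -- for each, and `φ` will be 1 on all of them.
  let ι := {p : Ideal R // p.IsMaximal ∧ ∃ a : R, a ≠ 0 ∧ ∀ y ∈ p, y * a = 0}
  choose a ha0 ha using fun p : ι ↦ p.2.2
  have hli : LinearIndependent K a := by
    classical
    rw [linearIndependent_iff']
    intro s c hc p hps
    -- Multiplying the relation by an `e` outside `p` but inside the other maximal ideals isolates
    -- the term at `p`.
    have hex : ∃ e ∉ p.1, ∀ q ∈ s, q ≠ p → e ∈ q.1 := by
      by_contra! hcon
      have hle : ∏ q ∈ s.erase p, q.1 ≤ p.1 := by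
        intro e he
        by_contra hep
        obtain ⟨q, hq, hqp, heq⟩ := hcon e hep
        exact heq (Ideal.prod_le_inf.trans (Finset.inf_le (Finset.mem_erase.2 ⟨hqp, hq⟩)) he)
      obtain ⟨q, hq, hqp⟩ := (p.2.1.isPrime.prod_le).1 hle
      have := q.2.1.eq_of_le p.2.1.ne_top hqp
      exact (Finset.mem_erase.1 hq).1 (Subtype.ext this)
    obtain ⟨e, hep, he⟩ := hex
    have h1 : e * (c p • a p) = 0 := by
      have h2 : e * ∑ q ∈ s, c q • a q = 0 := by rw [hc, mul_zero]
      rw [Finset.mul_sum, Finset.sum_eq_single_of_mem p hps] at h2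
      · exact h2
      · intro q hq hqp
        rw [mul_smul_comm, ha q e (he q hq hqp), smul_zero]
    have h3 : c p • a p ∈ (⊥ : Ideal R) := by
      refine mem_ideal_of_mul_mem_of_notMem p.2.1 hep (fun y hy ↦ ?_) (by simpa using h1)
      rw [mul_smul_comm, ha p y hy, smul_zero]
    rw [Ideal.mem_bot, smul_eq_zero] at h3
    exact h3.resolve_right (ha0 p)
  obtain ⟨φ, hφ⟩ : ∃ φ : R →ₗ[K] K, ∀ p, φ (a p) = 1 := by
    obtain ⟨φ, hφ⟩ := LinearMap.exists_extend
      ((Module.Basis.span hli).constr K (fun _ : ι ↦ (1 : K)))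
    refine ⟨φ, fun p ↦ ?_⟩
    have h1 := (Module.Basis.span hli).constr_basis K (fun _ : ι ↦ (1 : K)) p
    rw [← hφ] at h1
    simpa [Module.Basis.span_apply] using h1
  refine ⟨φ, fun x hx ↦ ?_⟩
  by_contra hne
  obtain ⟨p, hp, r, hr0, hr⟩ := exists_isMaximal_mul_annihilated hne
  let P : ι := ⟨p, hp, _, hr0, hr⟩
  -- A multiple of `x` lies in the `p`-socle, so it generates the chosen `a P`, on which `φ` is 1,
  -- although `φ` vanishes on all multiples of `x`.
  obtain ⟨z, hz⟩ := Ideal.mem_span_singleton'.1 (hR p hp _ (a P) hr (ha P) hr0)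
  have h1 := hφ P
  rw [← hz, ← mul_assoc, hx] at h1
  exact zero_ne_one h1

/-- The pairing identifies `R` with its `K`-dual. In Baer's criterion it thus suffices to extend the
`K`-functional `φ ∘ g` from `I` to `R`. -/
theorem injective_of_nondegenerate_functional {K R : Type*} [Field K] [CommRing R]
    [Algebra K R] [Module.Finite K R] (φ : R →ₗ[K] K)
    (hφ : ∀ x, (∀ y, φ (y * x) = 0) → x = 0) : Module.Injective R R := by
  refine Module.Baer.injective fun I g ↦ ?_
  obtain ⟨ψ, hψ⟩ := LinearMap.exists_extend (p := I.restrictScalars K)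
    (φ ∘ₗ g.restrictScalars K)
  let θ : R →ₗ[K] Module.Dual K R := (LinearMap.mul K R).compr₂ φ
  have hθ : Function.Injective θ := by
    rw [← LinearMap.ker_eq_bot, LinearMap.ker_eq_bot']
    intro x hx
    refine hφ x fun y ↦ ?_
    have := LinearMap.congr_fun hx y
    simpa [θ, mul_comm] using this
  obtain ⟨r, hr⟩ := (LinearMap.injective_iff_surjective_of_finrank_eq_finrank
    (Subspace.dual_finrank_eq (K := K) (V := R)).symm).1 hθ ψ
  refine ⟨LinearMap.toSpanSingleton R R r, fun x hx ↦ ?_⟩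
  rw [← sub_eq_zero]
  refine hφ _ fun y ↦ ?_
  have h1 : ψ (y * x) = φ (g ⟨y * x, I.mul_mem_left y hx⟩) :=
    LinearMap.congr_fun hψ ⟨y * x, I.mul_mem_left y hx⟩
  have h2 := g.map_smul y ⟨x, hx⟩
  have h3 := LinearMap.congr_fun hr (y * x)
  have h4 : (⟨y * x, I.mul_mem_left y hx⟩ : I) = y • ⟨x, hx⟩ := rfl
  rw [h4, h2] at h1
  have h5 : φ (r * (y * x)) = φ (y * g ⟨x, hx⟩) := h3.trans h1
  rw [mul_sub, map_sub, sub_eq_zero, ← smul_eq_mul y (g _), smul_eq_mul y (g _), ← h5]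
  simp [mul_left_comm, mul_comm]

theorem HasSimpleSocles.localization {R : Type*} [CommRing R] [IsArtinianRing R]
    (hR : HasSimpleSocles R) (p : Ideal R) [hp : p.IsMaximal] :
    HasSimpleSocles (Localization.AtPrime p) := by
  intro q hq a' b' ha' hb' hne
  have hsurj := IsArtinianRing.localization_surjective p.primeCompl (Localization.AtPrime p)
  obtain rfl : q = IsLocalRing.maximalIdeal (Localization.AtPrime p) :=
    IsLocalRing.eq_maximalIdeal hq
  obtain ⟨a, rfl⟩ := hsurj a'
  obtain ⟨b, rfl⟩ := hsurj b'
  -- The kernel of localization is finitely generated, so one `s` kills all of it; multiplication by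
  -- `s` then lifts socle elements to socle elements.
  obtain ⟨s, hs⟩ : ∃ s : p.primeCompl, ∀ x ∈ RingHom.ker (algebraMap R (Localization.AtPrime p)),
      (s : R) * x = 0 := by
    obtain ⟨t, ht⟩ := IsNoetherian.noetherian
      (RingHom.ker (algebraMap R (Localization.AtPrime p)))
    have h1 : ∀ x : t, ∃ s : p.primeCompl, (s : R) * x = 0 := by
      intro x
      have hx : (x : R) ∈ RingHom.ker (algebraMap R (Localization.AtPrime p)) := by
        rw [← ht]; exact Submodule.subset_span x.2
      exact (IsLocalization.map_eq_zero_iff p.primeCompl (Localization.AtPrime p) (x : R)).1 hx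
    choose s hs using h1
    refine ⟨∏ x, s x, fun x hx ↦ ?_⟩
    rw [← ht] at hx
    induction hx using Submodule.span_induction with
    | mem x hx =>
      obtain ⟨c, hc⟩ := Finset.dvd_prod_of_mem s (Finset.mem_univ (⟨x, hx⟩ : t))
      rw [hc, Submonoid.coe_mul, mul_right_comm, hs ⟨x, hx⟩, zero_mul]
    | zero => rw [mul_zero]
    | add x y _ _ hx hy => rw [mul_add, hx, hy, add_zero]
    | smul r x _ hx => rw [smul_eq_mul, mul_left_comm, hx, mul_zero]
  have hkill : ∀ c : R, (∀ x ∈ IsLocalRing.maximalIdeal (Localization.AtPrime p),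
      x * algebraMap R (Localization.AtPrime p) c = 0) → ∀ x ∈ p, x * (s * c) = 0 := by
    intro c hc x hx
    rw [mul_left_comm]
    refine hs _ ?_
    rw [RingHom.mem_ker, map_mul]
    exact hc _ ((IsLocalization.AtPrime.to_map_mem_maximal_iff _ p x).2 hx)
  have hu : IsUnit (algebraMap R (Localization.AtPrime p) s) := IsLocalization.map_units _ s
  have h0 : (s : R) * a ≠ 0 := by
    intro h
    have := congrArg (algebraMap R (Localization.AtPrime p)) h
    rw [map_mul, map_zero, hu.mul_right_eq_zero] at this
    exact hne this
  obtain ⟨r, hr⟩ := Ideal.mem_span_singleton'.1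
    (hR p hp (s * a) (s * b) (hkill a ha') (hkill b hb') h0)
  refine Ideal.mem_span_singleton'.2 ⟨algebraMap R _ r, hu.mul_left_cancel ?_⟩
  rw [← map_mul, ← map_mul, ← map_mul, ← hr]
  congr 1
  ring

theorem HasSimpleSocles.of_localization {R : Type*} [CommRing R]
    (h : ∀ (p : Ideal R) [p.IsMaximal], HasSimpleSocles (Localization.AtPrime p)) :
    HasSimpleSocles R := by
  intro p hp a b ha hb hne
  refine mem_span_singleton_of_localization (p := p) ha hb ?_
  have hkill : ∀ c : R, (∀ x ∈ p, x * c = 0) →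
      ∀ x ∈ IsLocalRing.maximalIdeal (Localization.AtPrime p),
        x * algebraMap R (Localization.AtPrime p) c = 0 := by
    intro c hc x hx
    rw [← Localization.AtPrime.map_eq_maximalIdeal] at hx
    obtain ⟨⟨y, s⟩, hy⟩ :=
      (IsLocalization.mem_map_algebraMap_iff p.primeCompl (Localization.AtPrime p)).1 hx
    refine (IsLocalization.map_units (Localization.AtPrime p) s).mul_left_cancel ?_
    rw [mul_zero, ← mul_assoc, mul_comm _ x, hy, ← map_mul, hc _ y.2, map_zero]
  refine h p _ inferInstance _ _ (hkill a ha) (hkill b hb) fun h0 ↦ hne ?_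
  obtain ⟨s, hs⟩ := (IsLocalization.map_eq_zero_iff p.primeCompl _ _).1 h0
  simpa using mem_ideal_of_mul_mem_of_notMem hp (I := ⊥) s.2 ha (by simpa using hs)

end Socle

/-! ### Finite injective dimension over Artinian rings -/

section InjectiveDimension

open CategoryTheory Abelian

variable {R : Type u} [CommRing R]

/-- If `R` embeds all its residue rings at primes and `Ext^(j+1)(-, R)` vanishes on
finitely generated modules, then so does `Ext^j(-, R)`, for `j ≥ 1`. -/
theorem subsingleton_ext_of_subsingleton_ext_succ [IsNoetherianRing R]
    (hR : ∀ p : PrimeSpectrum R, ∃ f : R ⧸ p.1 →ₗ[R] R, Function.Injective f) {j : ℕ}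
    (hj : ∀ (N : Type u) [AddCommGroup N] [Module R N] [Module.Finite R N],
      Subsingleton (Ext (ModuleCat.of R N) (ModuleCat.of R R) (j + 2)))
    (N : Type u) [AddCommGroup N] [Module R N] [hN : Module.Finite R N] :
    Subsingleton (Ext (ModuleCat.of R N) (ModuleCat.of R R) (j + 1)) := by
  induction hN using IsNoetherianRing.induction_on_isQuotientEquivQuotientPrime R with
  | subsingleton N =>
    have : Projective (ModuleCat.of R N) :=
      (ModuleCat.isZero_of_subsingleton (ModuleCat.of R N)).projective
    exact subsingleton_of_forall_eq 0 fun e ↦ Ext.eq_zero_of_projective e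
  | quotient N p e =>
    obtain ⟨f, hf⟩ := hR p
    let g : N →ₗ[R] R := f ∘ₗ e.toLinearMap
    have hg : Function.Injective g := hf.comp e.injective
    have hexact : Function.Exact g (LinearMap.range g).mkQ := LinearMap.exact_map_mkQ_range g
    let S : ShortComplex (ModuleCat.{u} R) :=
      ModuleCat.shortComplexOfCompEqZero g (LinearMap.range g).mkQ hexact.linearMap_comp_eq_zero
    have hS : S.ShortExact := ModuleCat.shortComplex_shortExact S hexact hg
      (Submodule.mkQ_surjective _)
    have : Projective S.X₂ := ModuleCat.projective_of_free (Module.Basis.singleton PUnit.{1} R)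
    -- Dimension shift along `0 → N → R → R/N → 0`, whose middle term is projective.
    have := hj (R ⧸ LinearMap.range g)
    refine subsingleton_of_forall_eq 0 fun x ↦ ?_
    obtain ⟨y, rfl⟩ := Ext.contravariant_sequence_exact₁ hS (ModuleCat.of R R) x
      (n₁ := j + 2) (by omega) (Subsingleton.elim (α := Ext (ModuleCat.of R (R ⧸ LinearMap.range g))
        (ModuleCat.of R R) (j + 2)) _ _)
    rw [Ext.eq_zero_of_projective y, Ext.comp_zero]
  | exact N₁ N₂ N₃ f g hf hg hfg h₁ h₃ =>
    let S : ShortComplex (ModuleCat.{u} R) :=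
      ModuleCat.shortComplexOfCompEqZero f g hfg.linearMap_comp_eq_zero
    have hS : S.ShortExact := ModuleCat.shortComplex_shortExact S hfg hf hg
    refine subsingleton_of_forall_eq 0 fun x ↦ ?_
    obtain ⟨y, rfl⟩ := Ext.contravariant_sequence_exact₂ hS (ModuleCat.of R R) x
      (h₁.elim _ _)
    rw [h₃.elim y 0, Ext.comp_zero]

theorem injective_of_subsingleton_ext_one
    (h : ∀ (N : Type u) [AddCommGroup N] [Module R N] [Module.Finite R N],
      Subsingleton (Ext (ModuleCat.of R N) (ModuleCat.of R R) 1)) : Module.Injective R R := by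
  refine Module.Baer.injective fun I g ↦ ?_
  have hexact : Function.Exact I.subtype I.mkQ := LinearMap.exact_subtype_mkQ I
  let S : ShortComplex (ModuleCat.{u} R) :=
    ModuleCat.shortComplexOfCompEqZero I.subtype I.mkQ hexact.linearMap_comp_eq_zero
  have hS : S.ShortExact := ModuleCat.shortComplex_shortExact S hexact I.injective_subtype
    (Submodule.mkQ_surjective _)
  obtain ⟨y, hy⟩ := Ext.contravariant_sequence_exact₁ hS (ModuleCat.of R R)
    (Ext.mk₀ (ModuleCat.ofHom g : S.X₁ ⟶ ModuleCat.of R R)) (n₁ := 1) rfl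
    ((h (R ⧸ I)).elim _ _)
  obtain ⟨z, rfl⟩ := (Ext.mk₀_bijective _ _).2 y
  rw [Ext.mk₀_comp_mk₀] at hy
  have hz := (Ext.mk₀_bijective _ _).1 hy
  refine ⟨z.hom, fun x hx ↦ ?_⟩
  exact LinearMap.congr_fun (congrArg ModuleCat.Hom.hom hz) ⟨x, hx⟩

theorem injective_of_hasInjectiveDimensionLE [IsNoetherianRing R]
    (hR : ∀ p : PrimeSpectrum R, ∃ f : R ⧸ p.1 →ₗ[R] R, Function.Injective f) {d : ℕ}
    (hd : HasInjectiveDimensionLE (ModuleCat.of R R) d) : Module.Injective R R := by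
  have key : ∀ k ≤ d, ∀ (N : Type u) [AddCommGroup N] [Module R N] [Module.Finite R N],
      Subsingleton (Ext (ModuleCat.of R N) (ModuleCat.of R R) (k + 1)) := by
    intro k hk
    induction hk using Nat.decreasingInduction with
    | self =>
      intro N _ _ _
      exact HasInjectiveDimensionLT.subsingleton _ (d + 1) _ le_rfl _
    | of_succ k _ ih =>
      intro N _ _ _
      exact subsingleton_ext_of_subsingleton_ext_succ hR ih N
  exact injective_of_subsingleton_ext_one (key 0 d.zero_le)

/-- The only prime is the maximal ideal, and some prime is associated to `R`. -/
theorem exists_injective_quotient_prime [IsArtinianRing R] [IsLocalRing R] (p : PrimeSpectrum R) :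
    ∃ f : R ⧸ p.1 →ₗ[R] R, Function.Injective f := by
  obtain ⟨q, hq⟩ := associatedPrimes.nonempty R R
  obtain ⟨hqp, hf⟩ := (isAssociatedPrime_iff_exists_injective_linearMap _ _).1 hq
  have hp : p.1 = q := by
    rw [IsLocalRing.eq_maximalIdeal (IsArtinianRing.isMaximal_of_isPrime p.1),
      IsLocalRing.eq_maximalIdeal (IsArtinianRing.isMaximal_of_isPrime q)]
  rw [hp]
  exact hf

theorem isGorensteinRing_iff_hasSimpleSocles (K : Type*) [Field K] [Algebra K R]
    [Module.Finite K R] : IsGorensteinRing R ↔ HasSimpleSocles R := by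
  have : IsArtinianRing R := IsArtinianRing.of_finite K R
  have hart (p : Ideal R) [p.IsMaximal] : IsArtinianRing (Localization.AtPrime p) :=
    (IsArtinianRing.localization_surjective p.primeCompl
      (Localization.AtPrime p)).isArtinianRing
  refine ⟨fun h ↦ .of_localization fun p hp ↦ ?_, fun h ↦ ⟨inferInstance, fun p hp ↦ ⟨0, ?_⟩⟩⟩
  · obtain ⟨d, hd⟩ := h.2 p
    have := hart p
    exact hasSimpleSocles_of_injective
      (injective_of_hasInjectiveDimensionLE exists_injective_quotient_prime hd)
  · have : Module.Finite K (Localization.AtPrime p) :=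
      Module.Finite.of_surjective (IsScalarTower.toAlgHom K R (Localization.AtPrime p)).toLinearMap
        (IsArtinianRing.localization_surjective p.primeCompl (Localization.AtPrime p))
    obtain ⟨φ, hφ⟩ := (h.localization p).exists_nondegenerate_functional (K := K)
    have hinj : Injective (ModuleCat.of (Localization.AtPrime p) (Localization.AtPrime p)) :=
      (Module.injective_iff_injective_object _ _).1 (injective_of_nondegenerate_functional φ hφ)
    infer_instance

end InjectiveDimension

/-! ### Ohm–Rush content in a free algebra -/

section Content

variable {R S ι : Type*} [CommRing R] [CommRing S] [Algebra R S]

theorem mem_map_algebraMap_iff_repr (b : Module.Basis ι R S) (I : Ideal R) (f : S) :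
    f ∈ I.map (algebraMap R S) ↔ ∀ i, b.repr f i ∈ I := by
  have hI : f ∈ I.map (algebraMap R S) ↔ f ∈ I • (⊤ : Submodule R S) := by
    rw [Ideal.smul_top_eq_map, Submodule.restrictScalars_mem]
  rw [hI]
  refine ⟨fun h i ↦ ?_, fun h ↦ ?_⟩
  · refine Submodule.smul_induction_on h (fun r hr n _ ↦ ?_) (fun x y hx hy ↦ ?_)
    · rw [map_smul, Finsupp.smul_apply, smul_eq_mul]
      exact I.mul_mem_right _ hr
    · rw [map_add, Finsupp.add_apply]
      exact I.add_mem hx hy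
  · rw [← b.linearCombination_repr f]
    exact Submodule.sum_mem _ fun i _ ↦ Submodule.smul_mem_smul (h i) trivial

/-- Membership in an extended ideal is tested on coordinates, so extension commutes with
intersections and the content is itself the smallest ideal of its family. -/
theorem ohmRushContent_le_iff (b : Module.Basis ι R S) {I : Ideal R} {f : S} :
    ohmRushContent R f ≤ I ↔ f ∈ I.map (algebraMap R S) := by
  have hI (I : Ideal R) : f ∈ I.map (algebraMap R S) ↔ f ∈ I • (⊤ : Submodule R S) := by
    rw [Ideal.smul_top_eq_map, Submodule.restrictScalars_mem]
  refine ⟨fun h ↦ ?_, fun h ↦ sInf_le ((hI I).1 h)⟩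
  refine Ideal.map_mono h ?_
  rw [mem_map_algebraMap_iff_repr b]
  intro i
  refine (Submodule.mem_sInf).2 fun J hJ ↦ ?_
  exact (mem_map_algebraMap_iff_repr b J f).1 ((hI J).2 hJ) i

theorem mem_map_ohmRushContent (b : Module.Basis ι R S) (f : S) :
    f ∈ (ohmRushContent R f).map (algebraMap R S) :=
  (ohmRushContent_le_iff b).1 le_rfl

theorem repr_mem_ohmRushContent (b : Module.Basis ι R S) (f : S) (i : ι) :
    b.repr f i ∈ ohmRushContent R f :=
  (mem_map_algebraMap_iff_repr b _ f).1 (mem_map_ohmRushContent b f) i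

theorem ohmRushContent_mul_le (b : Module.Basis ι R S) (f g : S) :
    ohmRushContent R (f * g) ≤ ohmRushContent R f * ohmRushContent R g := by
  rw [ohmRushContent_le_iff b, Ideal.map_mul]
  exact Ideal.mul_mem_mul (mem_map_ohmRushContent b f) (mem_map_ohmRushContent b g)

end Content

/-! ### From locally principal contents to simple socles -/

section SocleOfGaussian

variable {K R S ι : Type*} [Field K] [CommRing R] [CommRing S] [Algebra K R] [Algebra R S]
  [Algebra K S] [IsScalarTower K R S] {t : S}

/-- With `q` the minimal polynomial of `r`, `t - r` divides `q(t) - q(r) = q(t)`, a unit. -/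
theorem isUnit_sub_algebraMap_of_isUnit_aeval [Algebra.IsIntegral K R]
    (ht : ∀ q : Polynomial K, q ≠ 0 → IsUnit (Polynomial.aeval t q)) (r : R) :
    IsUnit (t - algebraMap R S r) := by
  have hr : IsIntegral K r := Algebra.IsIntegral.isIntegral r
  refine isUnit_of_dvd_unit ?_ (ht (minpoly K r) (minpoly.ne_zero hr))
  have h := Polynomial.sub_dvd_eval_sub t (algebraMap R S r)
    ((minpoly K r).map (algebraMap K S))
  rwa [Polynomial.eval_map_algebraMap, Polynomial.eval_map_algebraMap,
    Polynomial.aeval_algebraMap_apply, minpoly.aeval, map_zero, sub_zero] at h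

theorem mem_map_of_mul_sub_mem_map [Algebra.IsIntegral K R]
    (ht : ∀ q : Polynomial K, q ≠ 0 → IsUnit (Polynomial.aeval t q)) {p : Ideal R}
    (hp : p.IsMaximal) {α β : R} (hβ : β ∉ p) {g : S}
    (h : (algebraMap R S β * t - algebraMap R S α) * g ∈ p.map (algebraMap R S)) :
    g ∈ p.map (algebraMap R S) := by
  obtain ⟨γ, i, hi, hγ⟩ := hp.exists_inv hβ
  obtain ⟨c, hc⟩ := (isUnit_sub_algebraMap_of_isUnit_aeval ht (γ * α)).exists_left_inv
  have hi' := Ideal.mem_map_of_mem (algebraMap R S) hi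
  have h1 : g = c * (algebraMap R S γ * ((algebraMap R S β * t - algebraMap R S α) * g)) +
      c * t * g * algebraMap R S i := by
    have h2 : algebraMap R S γ * algebraMap R S β + algebraMap R S i = 1 := by
      rw [← map_mul, ← map_add, hγ, map_one]
    rw [map_mul] at hc
    linear_combination (-g) * hc - c * t * g * h2
  rw [h1]
  exact Ideal.add_mem _ (Ideal.mul_mem_left _ _ (Ideal.mul_mem_left _ _ h))
    (Ideal.mul_mem_left _ _ hi')

/-- If `a` and `b` are killed by `p`, then the content of `(a + b t) g` contains `a` and `b`
as soon as `g` does not vanish modulo `p`. -/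
theorem mem_of_add_mul_mul_mem_map [Algebra.IsIntegral K R] (e : Module.Basis ι R S)
    (ht : ∀ q : Polynomial K, q ≠ 0 → IsUnit (Polynomial.aeval t q)) {p : Ideal R}
    (hp : p.IsMaximal) {a b : R} (ha : ∀ x ∈ p, x * a = 0) (hb : ∀ x ∈ p, x * b = 0) {g : S}
    (hg : g ∉ p.map (algebraMap R S)) {I : Ideal R}
    (h : (algebraMap R S a + algebraMap R S b * t) * g ∈ I.map (algebraMap R S)) :
    a ∈ I ∧ b ∈ I := by
  have hI : ∀ i, a * e.repr g i + b * e.repr (t * g) i ∈ I := by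
    intro i
    have h1 := (mem_map_algebraMap_iff_repr e I _).1 h i
    have h2 : (algebraMap R S a + algebraMap R S b * t) * g = a • g + b • (t * g) := by
      rw [Algebra.smul_def, Algebra.smul_def]
      ring
    simpa [h2] using h1
  obtain ⟨j, hj⟩ : ∃ j, e.repr g j ∉ p := by
    rw [mem_map_algebraMap_iff_repr e] at hg
    exact not_forall.1 hg
  -- If all these minors vanished modulo `p`, then `(g_j t - (tg)_j) g` would lie in `pS`; the first
  -- factor is a unit modulo `p`, which would force `g ∈ pS`.
  obtain ⟨i, hi⟩ : ∃ i, e.repr g j * e.repr (t * g) i - e.repr (t * g) j * e.repr g i ∉ p := by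
    by_contra! hcon
    refine hg (mem_map_of_mul_sub_mem_map ht hp (α := e.repr (t * g) j) hj ?_)
    rw [mem_map_algebraMap_iff_repr e]
    intro i
    have h2 : (algebraMap R S (e.repr g j) * t - algebraMap R S (e.repr (t * g) j)) * g =
        e.repr g j • (t * g) - e.repr (t * g) j • g := by
      rw [Algebra.smul_def, Algebra.smul_def]
      ring
    simpa [h2] using hcon i
  constructor
  · refine mem_ideal_of_mul_mem_of_notMem hp hi ha ?_
    have := I.sub_mem (I.mul_mem_left (e.repr (t * g) i) (hI j))
      (I.mul_mem_left (e.repr (t * g) j) (hI i))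
    convert this using 1
    ring
  · refine mem_ideal_of_mul_mem_of_notMem hp hi hb ?_
    have := I.sub_mem (I.mul_mem_left (e.repr g j) (hI i))
      (I.mul_mem_left (e.repr g i) (hI j))
    convert this using 1
    ring

theorem isGaussianElement_add_mul [Algebra.IsIntegral K R] (e : Module.Basis ι R S)
    (ht : ∀ q : Polynomial K, q ≠ 0 → IsUnit (Polynomial.aeval t q)) {p : Ideal R}
    (hp : p.IsMaximal) {a b : R} (ha : ∀ x ∈ p, x * a = 0) (hb : ∀ x ∈ p, x * b = 0) :
    IsGaussianElement R (algebraMap R S a + algebraMap R S b * t) := by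
  intro g
  have hf : ohmRushContent R (algebraMap R S a + algebraMap R S b * t) ≤ Ideal.span {a, b} := by
    rw [ohmRushContent_le_iff e]
    exact Ideal.add_mem _ (Ideal.mem_map_of_mem _ (Ideal.subset_span (by simp)))
      (Ideal.mul_mem_right _ _ (Ideal.mem_map_of_mem _ (Ideal.subset_span (by simp))))
  refine le_antisymm (ohmRushContent_mul_le e _ _) ?_
  by_cases hg : g ∈ p.map (algebraMap R S)
  · have h0 : Ideal.span {a, b} * p = ⊥ := by
      rw [eq_bot_iff, Ideal.mul_le]
      intro r hr s hs
      obtain ⟨x, y, rfl⟩ := Ideal.mem_span_pair.1 hr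
      rw [Ideal.mem_bot]
      linear_combination x * ha s hs + y * hb s hs
    refine (Ideal.mul_mono hf ((ohmRushContent_le_iff e).2 hg)).trans ?_
    rw [h0]
    exact bot_le
  · obtain ⟨h1, h2⟩ := mem_of_add_mul_mul_mem_map e ht hp ha hb hg
      (mem_map_ohmRushContent e ((algebraMap R S a + algebraMap R S b * t) * g))
    refine Ideal.mul_le_left.trans (hf.trans ?_)
    rw [Ideal.span_le]
    rintro x (rfl | rfl)
    exacts [h1, h2]

theorem exists_mem_map_eq_span_of_isPrincipal {p : Ideal R} [p.IsPrime] {I : Ideal R}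
    (h : (I.map (algebraMap R (Localization.AtPrime p))).IsPrincipal) :
    ∃ c ∈ I, I.map (algebraMap R (Localization.AtPrime p)) =
      Ideal.span {algebraMap R (Localization.AtPrime p) c} := by
  obtain ⟨z, hz⟩ := h.principal
  have hzI : z ∈ I.map (algebraMap R (Localization.AtPrime p)) := by
    rw [hz]
    exact Submodule.mem_span_singleton_self z
  obtain ⟨⟨c, s⟩, hc⟩ := (IsLocalization.mem_map_algebraMap_iff p.primeCompl _).1 hzI
  refine ⟨c, c.2, ?_⟩
  rw [← hc, Ideal.span_singleton_mul_right_unit (IsLocalization.map_units _ s), hz]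

theorem hasSimpleSocles_of_isLocallyPrincipalIdeal [Algebra.IsIntegral K R] [Nonempty ι]
    (e : Module.Basis ι R S)
    (ht : ∀ q : Polynomial K, q ≠ 0 → IsUnit (Polynomial.aeval t q))
    (h : ∀ f : S, IsGaussianElement R f → IsLocallyPrincipalIdeal (ohmRushContent R f)) :
    HasSimpleSocles R := by
  intro p hp a b ha hb hne
  have hprin := h _ (isGaussianElement_add_mul e ht hp ha hb) p
  have hpne : (1 : S) ∉ p.map (algebraMap R S) := by
    intro h1
    obtain ⟨i⟩ := ‹Nonempty ι›
    have h2 := (mem_map_algebraMap_iff_repr e p (e i)).1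
      (by rw [(Ideal.eq_top_iff_one _).2 h1]; trivial) i
    rw [Module.Basis.repr_self, Finsupp.single_eq_same] at h2
    exact hp.ne_top ((Ideal.eq_top_iff_one p).2 h2)
  -- The choice `g = 1` puts `a` and `b` in the content of `a + bt` itself.
  obtain ⟨h1, h2⟩ := mem_of_add_mul_mul_mem_map e ht hp ha hb hpne
    (I := ohmRushContent R (algebraMap R S a + algebraMap R S b * t)) (by
      rw [mul_one]; exact mem_map_ohmRushContent e _)
  obtain ⟨c, hc, hcp⟩ := exists_mem_map_eq_span_of_isPrincipal hprin
  have hcab : c ∈ Ideal.span {a, b} := by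
    refine (ohmRushContent_le_iff e).2 ?_ hc
    exact Ideal.add_mem _ (Ideal.mem_map_of_mem _ (Ideal.subset_span (by simp)))
      (Ideal.mul_mem_right _ _ (Ideal.mem_map_of_mem _ (Ideal.subset_span (by simp))))
  obtain ⟨x, y, hxy⟩ := Ideal.mem_span_pair.1 hcab
  have hck : ∀ z ∈ p, z * c = 0 := fun z hz ↦ by
    rw [← hxy]
    linear_combination x * ha z hz + y * hb z hz
  have hac : a ∈ Ideal.span {c} := mem_span_singleton_of_localization (p := p) hck ha
    (hcp ▸ Ideal.mem_map_of_mem _ h1)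
  have hbc : b ∈ Ideal.span {c} := mem_span_singleton_of_localization (p := p) hck hb
    (hcp ▸ Ideal.mem_map_of_mem _ h2)
  obtain ⟨α, hα⟩ := Ideal.mem_span_singleton'.1 hac
  have hαp : α ∉ p := fun hmem ↦ hne (by rw [← hα, hck α hmem])
  have hca : c ∈ Ideal.span {a} := mem_ideal_of_mul_mem_of_notMem hp hαp hck
    (by rw [hα]; exact Ideal.mem_span_singleton_self a)
  exact (Ideal.span_singleton_le_iff_mem _).2 hca hbc

end SocleOfGaussian

/-! ### From simple socles to locally principal contents -/

section GaussianOfSocle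

variable {K R T S ι : Type*} [Field K] [CommRing R] [CommRing T] [CommRing S] [Algebra K R]
  [Algebra K T] [Algebra R S] [Algebra T S] [Algebra K S] [IsScalarTower K R S]
  [IsScalarTower K T S]

theorem IsGaussianElement.ohmRushContent_mul_eq_bot {f g : S} (hf : IsGaussianElement R f)
    (hfg : f * g = 0) : ohmRushContent R f * ohmRushContent R g = ⊥ := by
  rw [← hf g, hfg, eq_bot_iff]
  exact sInf_le (by
    rw [Set.mem_ofPred_eq]
    exact Submodule.zero_mem _)

theorem repr_algebraMap_smul (e : Module.Basis ι K T) (b : Module.Basis ι R S)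
    (hb : ∀ i, b i = algebraMap T S (e i)) (c : T) (w : R) (i : ι) :
    b.repr (c • algebraMap R S w) i = e.repr c i • w := by
  have h1 : c • algebraMap R S w =
      Finsupp.linearCombination R b ((e.repr c).mapRange (fun k ↦ k • w) (zero_smul K w)) := by
    rw [Finsupp.linearCombination_apply,
      Finsupp.sum_mapRange_index (fun i ↦ zero_smul R (b i))]
    conv_lhs => rw [← e.linearCombination_repr c, Finsupp.linearCombination_apply, Finsupp.sum,
      Finset.sum_smul]
    refine Finset.sum_congr rfl fun j _ ↦ ?_
    change _ = (e.repr c j • w) • b j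
    rw [hb j, Algebra.smul_def, Algebra.smul_def (_ • w), Algebra.smul_def, Algebra.smul_def,
      map_mul, map_mul, ← IsScalarTower.algebraMap_apply K T S,
      ← IsScalarTower.algebraMap_apply K R S]
    ring
  rw [h1, b.repr_linearCombination, Finsupp.mapRange_apply]

theorem mem_span_of_mem_map (e : Module.Basis ι K T) (b : Module.Basis ι R S)
    (hb : ∀ i, b i = algebraMap T S (e i)) {J : Ideal R} {κ : Type*} {z : κ → R}
    (hz : ∀ r ∈ J, r ∈ Submodule.span K (Set.range z)) {x : S}
    (hx : x ∈ J.map (algebraMap R S)) :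
    x ∈ Submodule.span T (Set.range fun k ↦ algebraMap R S (z k)) := by
  have key : ∀ r ∈ J, algebraMap R S r ∈
      Submodule.span T (Set.range fun k ↦ algebraMap R S (z k)) := by
    have hle : Submodule.span K (Set.range z) ≤ Submodule.comap
        (IsScalarTower.toAlgHom K R S).toLinearMap
        ((Submodule.span T (Set.range fun k ↦ algebraMap R S (z k))).restrictScalars K) := by
      rw [Submodule.span_le]
      rintro _ ⟨k, rfl⟩
      exact Submodule.subset_span ⟨k, rfl⟩
    exact fun r hr ↦ hle (hz r hr)
  rw [← b.linearCombination_repr x]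
  refine Submodule.sum_mem _ fun i _ ↦ ?_
  have h2 : b.repr x i • b i = e i • algebraMap R S (b.repr x i) := by
    rw [hb, Algebra.smul_def, Algebra.smul_def, mul_comm]
  change b.repr x i • b i ∈ _
  rw [h2]
  exact Submodule.smul_mem _ _ (key _ ((mem_map_algebraMap_iff_repr b J x).1 hx i))

/-- Lift a basis of the image of `𝔞` in `R / ann I` to elements `w_j` of `𝔞`. The products `f w_j`
are `T`-independent because `f` is Gaussian, and lie in `(𝔞I)S`, which `dim 𝔞I` elements span over
`T`. -/
theorem IsGaussianElement.finrank_le [Module.Finite K R] [Nontrivial T] (e : Module.Basis ι K T)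
    (b : Module.Basis ι R S) (hb : ∀ i, b i = algebraMap T S (e i)) {f : S}
    (hf : IsGaussianElement R f) (𝔞 : Ideal R) :
    Module.finrank K (𝔞.restrictScalars K) ≤
      Module.finrank K ((𝔞 * ohmRushContent R f).restrictScalars K) +
      Module.finrank K ((Submodule.annihilator (ohmRushContent R f)).restrictScalars K) := by
  set I := ohmRushContent R f
  have hA (x : R) : x ∈ 𝔞.restrictScalars K ↔ x ∈ 𝔞 := Iff.rfl
  have hB (x : R) : x ∈ (𝔞 * I).restrictScalars K ↔ x ∈ 𝔞 * I := Iff.rfl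
  have hN (x : R) : x ∈ (Submodule.annihilator I).restrictScalars K ↔
    x ∈ Submodule.annihilator I := Iff.rfl
  generalize 𝔞.restrictScalars K = A at hA ⊢
  generalize (𝔞 * I).restrictScalars K = B at hB ⊢
  generalize (Submodule.annihilator I).restrictScalars K = N at hN ⊢
  let θ : A →ₗ[K] R ⧸ N := N.mkQ ∘ₗ A.subtype
  have hker : Module.finrank K (LinearMap.ker θ) ≤ Module.finrank K N := by
    let ρ : LinearMap.ker θ →ₗ[K] N :=
      LinearMap.codRestrict _ (A.subtype ∘ₗ (LinearMap.ker θ).subtype)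
        (fun x ↦ by
          have := x.2
          rw [LinearMap.mem_ker] at this
          exact (Submodule.Quotient.mk_eq_zero _).1 this)
    refine LinearMap.finrank_le_finrank_of_injective (f := ρ) fun x y hxy ↦ ?_
    have h := congrArg Subtype.val hxy
    exact Subtype.ext (Subtype.ext h)
  have hrange : Module.finrank K (LinearMap.range θ) ≤ Module.finrank K B := by
    let v := Module.finBasis K (LinearMap.range θ)
    let z := Module.finBasis K B
    choose w hw using fun j ↦ (v j).2
    have hz : B ≤ Submodule.span K (Set.range fun k ↦ (z k : R)) := by
      have := congrArg (Submodule.map B.subtype) z.span_eq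
      rw [Submodule.map_span, ← Set.range_comp, Submodule.map_subtype_top] at this
      exact this.ge
    have hli : LinearIndependent T fun j ↦ f * algebraMap R S (w j) := by
      rw [Fintype.linearIndependent_iff]
      intro c hc
      set g := ∑ j, c j • algebraMap R S (w j)
      have hfg : f * g = 0 := by
        rw [Finset.mul_sum, ← hc]
        exact Finset.sum_congr rfl fun j _ ↦ mul_smul_comm _ _ _
      have hann : ∀ i, b.repr g i ∈ Submodule.annihilator I := by
        intro i
        rw [Submodule.mem_annihilator]
        intro r hr
        have h1 := Ideal.mul_mem_mul hr (repr_mem_ohmRushContent b g i)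
        rw [hf.ohmRushContent_mul_eq_bot hfg, Ideal.mem_bot] at h1
        rw [smul_eq_mul, mul_comm, h1]
      have hvli := v.linearIndependent
      rw [Fintype.linearIndependent_iff] at hvli
      intro j
      refine e.repr.map_eq_zero_iff.1 (Finsupp.ext fun i ↦ ?_)
      refine hvli (fun j ↦ e.repr (c j) i) ?_ j
      have h2 : b.repr g i = ∑ j, e.repr (c j) i • (w j : R) := by
        rw [map_sum, Finset.sum_apply']
        exact Finset.sum_congr rfl fun j _ ↦ repr_algebraMap_smul e b hb _ _ _
      refine Subtype.ext ?_
      have h3 : θ (∑ j, e.repr (c j) i • w j) = 0 := by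
        refine (Submodule.Quotient.mk_eq_zero _).2 ?_
        have := (hN _).2 (hann i)
        rw [h2] at this
        simpa using this
      rw [map_sum] at h3
      simpa [hw] using h3
    have := Fintype.ofFinite (Set.range fun k ↦ algebraMap R S (z k : R))
    have hmem (j) : f * algebraMap R S (w j) ∈
        Submodule.span T (Set.range fun k ↦ algebraMap R S (z k : R)) := by
      refine mem_span_of_mem_map e b hb (J := 𝔞 * I) (fun r hr ↦ hz ((hB r).2 hr)) ?_
      rw [mul_comm f, Ideal.map_mul]
      have h1 : (w j : R) ∈ 𝔞 := (hA (w j : R)).1 (w j).2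
      have h2 : algebraMap R S (w j : R) ∈ 𝔞.map (algebraMap R S) := Ideal.mem_map_of_mem _ h1
      exact Ideal.mul_mem_mul h2 (mem_map_ohmRushContent b f)
    have h4 := linearIndependent_le_span' _ hli (Set.range fun k ↦ algebraMap R S (z k : R))
      (Set.range_subset_iff.2 hmem)
    rw [Cardinal.mk_fin, Nat.cast_le] at h4
    refine h4.trans ((Fintype.card_range_le _).trans_eq (Fintype.card_fin _))
  have := LinearMap.finrank_range_add_finrank_ker θ
  omega

/-- The nondegenerate pairing embeds `ann I` into the functionals vanishing on `I`. -/
theorem HasSimpleSocles.finrank_add_finrank_annihilator_le [Module.Finite K R]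
    (hR : HasSimpleSocles R) (I : Ideal R) :
    Module.finrank K (I.restrictScalars K) +
      Module.finrank K ((Submodule.annihilator I).restrictScalars K) ≤ Module.finrank K R := by
  obtain ⟨φ, hφ⟩ := hR.exists_nondegenerate_functional (K := K)
  have hA (x : R) : x ∈ I.restrictScalars K ↔ x ∈ I := Iff.rfl
  have hN (x : R) : x ∈ (Submodule.annihilator I).restrictScalars K ↔
    x ∈ Submodule.annihilator I := Iff.rfl
  generalize I.restrictScalars K = A at hA ⊢
  generalize (Submodule.annihilator I).restrictScalars K = N at hN ⊢
  rw [← Subspace.finrank_add_finrank_dualAnnihilator_eq A]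
  refine Nat.add_le_add_left ?_ _
  let ρ : N →ₗ[K] A.dualAnnihilator :=
    LinearMap.codRestrict _ ((LinearMap.mul K R).compr₂ φ ∘ₗ N.subtype) (fun y ↦ by
      rw [Submodule.mem_dualAnnihilator]
      intro x hx
      have := Submodule.mem_annihilator.1 ((hN _).1 y.2) x ((hA x).1 hx)
      change φ ((y : R) * x) = 0
      rw [← smul_eq_mul, this, map_zero])
  refine LinearMap.finrank_le_finrank_of_injective (f := ρ) ?_
  rw [injective_iff_map_eq_zero]
  intro y hy
  refine Subtype.ext (hφ _ fun x ↦ ?_)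
  have := LinearMap.congr_fun (congrArg Subtype.val hy) x
  rw [mul_comm]
  exact this

/-- The hypothesis says `dim I/pI ≤ dim R/p`, so any `x` in `I` outside `pI` generates `I` modulo
`pI`. -/
theorem exists_le_span_singleton_sup_mul [Module.Finite K R] {p : Ideal R} (hp : p.IsMaximal)
    {I : Ideal R}
    (h : Module.finrank K (I.restrictScalars K) + Module.finrank K (p.restrictScalars K) ≤
      Module.finrank K ((p * I).restrictScalars K) + Module.finrank K R) :
    ∃ x ∈ I, I ≤ Ideal.span {x} ⊔ p * I := by
  by_cases hI : I ≤ p * I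
  · exact ⟨0, I.zero_mem, hI.trans le_sup_right⟩
  obtain ⟨x, hx, hxp⟩ := Set.not_subset.1 hI
  refine ⟨x, hx, ?_⟩
  have hA (x : R) : x ∈ I.restrictScalars K ↔ x ∈ I := Iff.rfl
  have hB (x : R) : x ∈ (p * I).restrictScalars K ↔ x ∈ p * I := Iff.rfl
  have hP (x : R) : x ∈ p.restrictScalars K ↔ x ∈ p := Iff.rfl
  generalize I.restrictScalars K = A at h hA
  generalize (p * I).restrictScalars K = B at h hB
  generalize p.restrictScalars K = P at h hP
  let θ : R × B →ₗ[K] R :=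
    ((LinearMap.mul K R).flip x).coprod (B).subtype
  have hθ (y) : θ y = y.1 * x + y.2 := rfl
  -- If `rx ∈ pI` with `r ∉ p`, inverting `r` modulo `p` would put `x` in `pI`; so the kernel embeds
  -- in `p`.
  have hker : Module.finrank K (LinearMap.ker θ) ≤ Module.finrank K (P) := by
    let ρ : LinearMap.ker θ →ₗ[K] P :=
      LinearMap.codRestrict _ (LinearMap.fst K _ _ ∘ₗ (LinearMap.ker θ).subtype) (fun y ↦ by
        have h0 := y.2
        rw [LinearMap.mem_ker, hθ] at h0
        rw [hP]
        by_contra hy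
        obtain ⟨c, i, hi, hci⟩ := hp.exists_inv hy
        refine hxp ?_
        have h1 : x = i * x - c * y.1.2 := by
          change c * y.1.1 + i = 1 at hci
          linear_combination (-x) * hci + c * h0
        rw [h1]
        exact sub_mem (Ideal.mul_mem_mul hi hx) (Ideal.mul_mem_left _ _ ((hB _).1 y.1.2.2)))
    refine LinearMap.finrank_le_finrank_of_injective (f := ρ) ?_
    rw [injective_iff_map_eq_zero]
    intro y hy
    have h1 : y.1.1 = 0 := congrArg Subtype.val hy
    have h0 := y.2
    rw [LinearMap.mem_ker, hθ, h1, zero_mul, zero_add] at h0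
    exact Subtype.ext (Prod.ext h1 (Subtype.ext h0))
  have hle : LinearMap.range θ ≤ A := by
    rintro _ ⟨y, rfl⟩
    have h1 : (y.2 : R) ∈ p * I := (hB (y.2 : R)).1 y.2.2
    exact (hA _).2 (I.add_mem (I.mul_mem_left _ hx) (Ideal.mul_le_right h1))
  have hrank := LinearMap.finrank_range_add_finrank_ker θ
  rw [Module.finrank_prod] at hrank
  have heq := Submodule.eq_of_le_of_finrank_le hle (by omega)
  intro y hy
  have hy' : y ∈ LinearMap.range θ := by
    rw [heq]; exact (hA y).2 hy
  obtain ⟨z, rfl⟩ := hy'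
  rw [hθ]
  have h1 : (z.2 : R) ∈ p * I := (hB (z.2 : R)).1 z.2.2
  have h2 : z.1 * x ∈ Ideal.span {x} := Ideal.mem_span_singleton'.2 ⟨z.1, rfl⟩
  exact Submodule.add_mem_sup h2 h1

theorem isPrincipal_map_of_le_span_singleton_sup_mul {p : Ideal R} [p.IsMaximal]
    [IsNoetherianRing R] {I : Ideal R} {x : R} (hx : x ∈ I) (h : I ≤ Ideal.span {x} ⊔ p * I) :
    (I.map (algebraMap R (Localization.AtPrime p))).IsPrincipal := by
  refine ⟨algebraMap R _ x, le_antisymm ?_ ?_⟩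
  · refine Submodule.le_of_le_smul_of_le_jacobson_bot (I := p.map (algebraMap R _))
      ((isNoetherianRing_iff_ideal_fg R).1 inferInstance I |>.map _) ?_ ?_
    · rw [Localization.AtPrime.map_eq_maximalIdeal, IsLocalRing.jacobson_eq_maximalIdeal _ bot_ne_top]
    · have := Ideal.map_mono (f := algebraMap R (Localization.AtPrime p)) h
      rwa [Ideal.map_sup, Ideal.map_mul, Ideal.map_span, Set.image_singleton] at this
  · exact (Ideal.span_singleton_le_iff_mem _).2 (Ideal.mem_map_of_mem _ hx)

theorem HasSimpleSocles.isLocallyPrincipalIdeal [Module.Finite K R] [Nontrivial T]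
    (hR : HasSimpleSocles R) (e : Module.Basis ι K T)
    (b : Module.Basis ι R S) (hb : ∀ i, b i = algebraMap T S (e i)) {f : S}
    (hf : IsGaussianElement R f) : IsLocallyPrincipalIdeal (ohmRushContent R f) := by
  intro p hp
  have : IsNoetherianRing R := IsNoetherianRing.of_finite K R
  have h1 := hf.finrank_le e b hb p
  have h2 := hR.finrank_add_finrank_annihilator_le (K := K) (ohmRushContent R f)
  obtain ⟨x, hx, hle⟩ := exists_le_span_singleton_sup_mul (K := K) hp
    (I := ohmRushContent R f) (by omega)
  exact isPrincipal_map_of_le_span_singleton_sup_mul hx hle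

end GaussianOfSocle

/-! ### Bases for the polynomial extension -/

section PolynomialExtension

/-- A basis of `B` over `A` induces one of `B / J B` over `A / J`. -/
theorem exists_basis_quotientMap {A B ι : Type*} [CommRing A] [CommRing B] [Algebra A B]
    (b : Module.Basis ι A B) (J : Ideal A) :
    letI : Algebra (A ⧸ J) (B ⧸ J.map (algebraMap A B)) :=
      (Ideal.quotientMap (J.map (algebraMap A B)) (algebraMap A B) Ideal.le_comap_map).toAlgebra
    ∃ c : Module.Basis ι (A ⧸ J) (B ⧸ J.map (algebraMap A B)),
      ∀ i, c i = Ideal.Quotient.mk (J.map (algebraMap A B)) (b i) := by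
  let : Algebra (A ⧸ J) (B ⧸ J.map (algebraMap A B)) :=
    (Ideal.quotientMap (J.map (algebraMap A B)) (algebraMap A B) Ideal.le_comap_map).toAlgebra
  have hsmul (a : A) (x : B) : Ideal.Quotient.mk J a • Ideal.Quotient.mk (J.map (algebraMap A B)) x
      = Ideal.Quotient.mk (J.map (algebraMap A B)) (a • x) := by
    rw [Algebra.smul_def, Algebra.smul_def, map_mul]
    rfl
  have hli : LinearIndependent (A ⧸ J)
      fun i ↦ Ideal.Quotient.mk (J.map (algebraMap A B)) (b i) := by
    classical
    rw [linearIndependent_iff']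
    intro s g hg i hi
    choose a ha using fun i ↦ Ideal.Quotient.mk_surjective (g i)
    have h1 : ∑ i ∈ s, a i • b i ∈ J.map (algebraMap A B) := by
      rw [← Ideal.Quotient.eq_zero_iff_mem, map_sum, ← hg]
      exact Finset.sum_congr rfl fun j _ ↦ by rw [← ha, hsmul]
    have h2 := (mem_map_algebraMap_iff_repr b J _).1 h1 i
    rw [map_sum, Finset.sum_apply', Finset.sum_eq_single_of_mem i hi] at h2
    · rw [← ha, Ideal.Quotient.eq_zero_iff_mem]
      simpa using h2
    · intro j _ hji
      simp [hji]
  refine ⟨Module.Basis.mk hli ?_, fun i ↦ Module.Basis.mk_apply _ _ i⟩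
  rintro x -
  obtain ⟨y, rfl⟩ := Ideal.Quotient.mk_surjective x
  rw [← b.linearCombination_repr y, Finsupp.linearCombination_apply, Finsupp.sum, map_sum]
  refine Submodule.sum_mem _ fun i _ ↦ ?_
  rw [← hsmul]
  exact Submodule.smul_mem _ _ (Submodule.subset_span ⟨i, rfl⟩)

variable {K : Type u} {L : Type v} [Field K] [Field L] [Algebra K L]

/-- The polynomial ring in `m + k` variables over `L` as a polynomial ring in `m` variables
over one in `k` variables. -/
noncomputable def mvPolynomialFinAddEquiv (L : Type*) [Field L] (m k : ℕ) :
    MvPolynomial (Fin m) (MvPolynomial (Fin k) L) ≃+* MvPolynomial (Fin (m + k)) L :=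
  ((MvPolynomial.sumAlgEquiv L (Fin m) (Fin k)).symm.trans
    (MvPolynomial.renameEquiv L finSumFinEquiv)).toRingEquiv

theorem mvPolynomialFinAddEquiv_map (m k : ℕ) (a : MvPolynomial (Fin m) K) :
    mvPolynomialFinAddEquiv L m k (MvPolynomial.map (algebraMap K (MvPolynomial (Fin k) L)) a) =
      polyExtHom K L (Nat.le_add_right m k) a := by
  suffices h : (mvPolynomialFinAddEquiv L m k : _ →+* _).comp
      (MvPolynomial.map (algebraMap K (MvPolynomial (Fin k) L))) =
      polyExtHom K L (Nat.le_add_right m k) from RingHom.congr_fun h a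
  refine MvPolynomial.ringHom_ext (fun r ↦ ?_) fun i ↦ ?_
  · simp [mvPolynomialFinAddEquiv, polyExtHom, MvPolynomial.algebraMap_eq,
      IsScalarTower.algebraMap_apply K L (MvPolynomial (Fin k) L)]
  · simp [mvPolynomialFinAddEquiv, polyExtHom]
    rfl

theorem mvPolynomialFinAddEquiv_C (m k : ℕ) (c : MvPolynomial (Fin k) L) :
    mvPolynomialFinAddEquiv L m k (MvPolynomial.C c) = MvPolynomial.rename (Fin.natAdd m) c := by
  suffices h : (mvPolynomialFinAddEquiv L m k).toRingHom.comp MvPolynomial.C =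
      (MvPolynomial.rename (R := L) (Fin.natAdd m)).toRingHom from RingHom.congr_fun h c
  refine MvPolynomial.ringHom_ext (fun r ↦ ?_) fun i ↦ ?_
  · simp [mvPolynomialFinAddEquiv]
  · simp [mvPolynomialFinAddEquiv]

/-- `A → B` is the base change of `K → L[x_{m+1}, …, x_n]` along `K → A`, so a `K`-basis becomes an
`A`-basis. -/
theorem exists_basis_polyExtHom {m k : ℕ} {ι : Type*}
    (e : Module.Basis ι K (MvPolynomial (Fin k) L)) :
    letI : Algebra (MvPolynomial (Fin m) K) (MvPolynomial (Fin (m + k)) L) :=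
      (polyExtHom K L (Nat.le_add_right m k)).toAlgebra
    ∃ b : Module.Basis ι (MvPolynomial (Fin m) K) (MvPolynomial (Fin (m + k)) L),
      ∀ i, b i = MvPolynomial.rename (Fin.natAdd m) (e i) := by
  let : Algebra (MvPolynomial (Fin m) K) (MvPolynomial (Fin (m + k)) L) :=
    (polyExtHom K L (Nat.le_add_right m k)).toAlgebra
  let : Algebra (MvPolynomial (Fin m) K) (MvPolynomial (Fin m) (MvPolynomial (Fin k) L)) :=
    MvPolynomial.algebraMvPolynomial
  have hpush : Algebra.IsPushout K (MvPolynomial (Fin m) K) (MvPolynomial (Fin k) L)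
    (MvPolynomial (Fin m) (MvPolynomial (Fin k) L)) := inferInstance
  let b := hpush.out.basis e
  let Ψ : MvPolynomial (Fin m) (MvPolynomial (Fin k) L) ≃ₐ[MvPolynomial (Fin m) K]
      MvPolynomial (Fin (m + k)) L :=
    AlgEquiv.ofRingEquiv (f := mvPolynomialFinAddEquiv L m k) fun a ↦
      mvPolynomialFinAddEquiv_map m k a
  refine ⟨b.map Ψ.toLinearEquiv, fun i ↦ ?_⟩
  rw [Module.Basis.map_apply, IsBaseChange.basis_apply]
  exact mvPolynomialFinAddEquiv_C m k (e i)

theorem finite_quotient_of_isFiniteLength {m : ℕ} {J : Ideal (MvPolynomial (Fin m) K)}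
    (hJ : IsFiniteLength (MvPolynomial (Fin m) K) (MvPolynomial (Fin m) K ⧸ J)) :
    Module.Finite K (MvPolynomial (Fin m) K ⧸ J) := by
  have h := (isFiniteLength_iff_isNoetherian_isArtinian.1 hJ).2
  have : IsArtinianRing (MvPolynomial (Fin m) K ⧸ J) :=
    isArtinian_of_tower (MvPolynomial (Fin m) K) h
  exact (Module.finite_iff_isArtinianRing K _).2 this

theorem aeval_ne_zero_of_notMem_range (hclosed : algebraicClosure K L = ⊥) {t : L}
    (ht : t ∉ Set.range (algebraMap K L)) {q : Polynomial K} (hq : q ≠ 0) :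
    Polynomial.aeval t q ≠ 0 := by
  intro h0
  refine ht ?_
  have : t ∈ algebraicClosure K L := mem_algebraicClosure_iff.2 ⟨q, hq, h0⟩
  rw [hclosed] at this
  exact IntermediateField.mem_bot.1 this

end PolynomialExtension

/-! ### The equivalence, abstractly and for polynomial rings -/

/-- If a `K`-basis of a nontrivial algebra `T` is an `R`-basis of `S`, for a finite `K`-algebra `R`,
and some `t` in `S` is such that `q(t)` is a unit for all nonzero `q` over `K`, then contents of
Gaussian elements are locally principal exactly when `R` is Gorenstein. -/
theorem gaussian_isLocallyPrincipalIdeal_iff_isGorensteinRing {K T S ι : Type*} {R : Type u}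
    [Field K] [CommRing R] [CommRing T] [CommRing S] [Algebra K R] [Algebra K T] [Algebra R S]
    [Algebra T S] [Algebra K S] [Module.Finite K R] [Nontrivial T]
    (hR : ∀ r, algebraMap K S r = algebraMap R S (algebraMap K R r))
    (hT : ∀ r, algebraMap K S r = algebraMap T S (algebraMap K T r))
    (e : Module.Basis ι K T) (b : Module.Basis ι R S) (hb : ∀ i, b i = algebraMap T S (e i))
    {t : S} (ht : ∀ q : Polynomial K, q ≠ 0 → IsUnit (Polynomial.aeval t q)) :
    (∀ f : S, IsGaussianElement R f → IsLocallyPrincipalIdeal (ohmRushContent R f)) ↔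
      IsGorensteinRing R := by
  have : IsScalarTower K R S := .of_algebraMap_eq hR
  have : IsScalarTower K T S := .of_algebraMap_eq hT
  have := e.index_nonempty
  rw [isGorensteinRing_iff_hasSimpleSocles K]
  exact ⟨hasSimpleSocles_of_isLocallyPrincipalIdeal b ht,
    fun h f hf ↦ h.isLocallyPrincipalIdeal e b hb hf⟩

theorem mainTheorem9 {K : Type u} {L : Type v} [Field K] [Field L] [Algebra K L]
    (hsep : IsSeparableFieldExtension K L)
    (hclosed : algebraicClosure K L = ⊥)
    (hnontrivial : ¬ Function.Surjective (algebraMap K L))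
    {m n : ℕ} (hmn : m ≤ n)
    (J : Ideal (MvPolynomial (Fin m) K))
    (hJ : IsFiniteLength (MvPolynomial (Fin m) K) (MvPolynomial (Fin m) K ⧸ J)) :
    letI : Algebra (MvPolynomial (Fin m) K ⧸ J)
        (MvPolynomial (Fin n) L ⧸ J.map (polyExtHom K L hmn)) :=
      (polyExtQuotHom K L hmn J).toAlgebra
    (∀ f : MvPolynomial (Fin n) L ⧸ J.map (polyExtHom K L hmn),
        IsGaussianElement (MvPolynomial (Fin m) K ⧸ J) f →
          IsLocallyPrincipalIdeal (ohmRushContent (MvPolynomial (Fin m) K ⧸ J) f)) ↔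
      IsGorensteinRing (MvPolynomial (Fin m) K ⧸ J) := by
  obtain ⟨k, rfl⟩ := Nat.exists_eq_add_of_le hmn
  let : Algebra (MvPolynomial (Fin m) K) (MvPolynomial (Fin (m + k)) L) :=
    (polyExtHom K L hmn).toAlgebra
  let : Algebra (MvPolynomial (Fin m) K ⧸ J)
      (MvPolynomial (Fin (m + k)) L ⧸ J.map (polyExtHom K L hmn)) :=
    (polyExtQuotHom K L hmn J).toAlgebra
  let : Algebra (MvPolynomial (Fin k) L)
      (MvPolynomial (Fin (m + k)) L ⧸ J.map (polyExtHom K L hmn)) :=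
    ((Ideal.Quotient.mk (J.map (polyExtHom K L hmn))).comp
      (MvPolynomial.rename (R := L) (Fin.natAdd m)).toRingHom).toAlgebra
  have hfin := finite_quotient_of_isFiniteLength hJ
  let e := Module.Basis.ofVectorSpace K (MvPolynomial (Fin k) L)
  obtain ⟨b, hb⟩ := exists_basis_polyExtHom (m := m) e
  obtain ⟨c, hc⟩ : ∃ c : Module.Basis _ (MvPolynomial (Fin m) K ⧸ J)
      (MvPolynomial (Fin (m + k)) L ⧸ J.map (polyExtHom K L hmn)),
      ∀ i, c i = Ideal.Quotient.mk _ (b i) := exists_basis_quotientMap b J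
  obtain ⟨t, ht⟩ := not_forall.1 hnontrivial
  refine gaussian_isLocallyPrincipalIdeal_iff_isGorensteinRing (fun r ↦ ?_) (fun r ↦ ?_) e c
    (fun i ↦ ?_)
    (t := algebraMap L (MvPolynomial (Fin (m + k)) L ⧸ J.map (polyExtHom K L hmn)) t)
    (fun q hq ↦ ?_)
  · change _ = Ideal.Quotient.mk (J.map (polyExtHom K L hmn)) (polyExtHom K L hmn (.C r))
    simp only [polyExtHom, RingHom.comp_apply, MvPolynomial.map_C]
    change _ = Ideal.Quotient.mk (J.map (polyExtHom K L hmn))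
      (MvPolynomial.rename _ (MvPolynomial.C _))
    rw [MvPolynomial.rename_C]
    rfl
  · change _ = Ideal.Quotient.mk (J.map (polyExtHom K L hmn))
      (MvPolynomial.rename _ (MvPolynomial.C _))
    rw [MvPolynomial.rename_C]
    rfl
  · rw [hc i, hb i]
    rfl
  -- `t` is transcendental over `K`, so `q(t)` is a nonzero element of the field `L`, and its image
  -- is a unit.
  · rw [Polynomial.aeval_algebraMap_apply]
    exact (aeval_ne_zero_of_notMem_range hclosed ht hq).isUnit.map _
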